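/- Let $A$ be a (not necessarily unital) complex $C^{*}$-algebra. Suppose that there exist a net of abelian (not necessarily unital or finite-dimensional) $C^{*}$-algebras $(F_{\alpha})$ and nets of contractive positive linear maps $\phi_{\alpha}\colon A \to F_{\alpha}$ and $\psi_{\alpha}\colon F_{\alpha} \to A$, indexed by the same directed set, such that for all $x \in A$, \[ \|x - \psi_{\alpha}(\phi_{\alpha}(x))\| \to 0 \quad\text{as } \alpha \to \infty . \] Then $A$ is abelian, that is, $ab = ba$ for all $a, b \in A$. -/

import Mathlib

open Filter Topology

/-! Kadison's inequality `P y * P y ≤ P (y * y)` for `0 ≤ y` lets the monotonicity of squaring on a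
commutative algebra pass through the factorization: if `0 ≤ a ≤ b`, then (ψφa)² ≤ ψ((φa)²) ≤
ψ((φb)²) ≤ ψφ(b²), and the limit is a² ≤ b². By Ogasawara's theorem this forces commutativity.
Kadison's inequality is obtained without units, by writing y as a combination of bumps `f i` applied
to y whose sum has norm at most 1. -/

/-- The operator Cauchy–Schwarz inequality for a finite subpartition of unity. -/
theorem sum_smul_mul_self_le {B κ : Type*} [NonUnitalCStarAlgebra B] [PartialOrder B]
    [StarOrderedRing B] (s : Finset κ) (a : κ → B) (l : κ → ℝ) (ha : ∀ i ∈ s, 0 ≤ a i)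
    (hs : ‖∑ i ∈ s, a i‖ ≤ 1) :
    (∑ i ∈ s, l i • a i) * (∑ i ∈ s, l i • a i) ≤ ∑ i ∈ s, (l i * l i) • a i := by
  set T := ∑ i ∈ s, l i • a i with hT
  have hTsa : star T = T := by
    simp only [hT, star_sum, star_smul, star_trivial]
    exact Finset.sum_congr rfl fun i hi => by rw [(IsSelfAdjoint.of_nonneg (ha i hi)).star_eq]
  have hterm : ∀ i ∈ s,
      0 ≤ (l i * l i) • a i - (T * (l i • a i) + (l i • a i) * T) + T * a i * T := by
    intro i hi
    obtain ⟨c, hc⟩ := CStarAlgebra.nonneg_iff_eq_star_mul_self.mp (ha i hi)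
    -- This square is (l i − T) a i (l i − T): a term of the variance of `l` about its mean T.
    have h := star_mul_self_nonneg (l i • c - c * T)
    refine h.trans_eq ?_
    rw [hc]
    simp only [star_sub, star_smul, star_mul, star_trivial, hTsa, mul_sub, sub_mul,
      smul_mul_assoc, mul_smul_comm, mul_assoc]
    module
  have hsum := Finset.sum_nonneg hterm
  rw [Finset.sum_add_distrib, Finset.sum_sub_distrib, Finset.sum_add_distrib, ← Finset.mul_sum,
    ← Finset.sum_mul, ← Finset.sum_mul, ← Finset.mul_sum, ← hT] at hsum
  have hS : T * (∑ i ∈ s, a i) * T ≤ T * T := by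
    have hSsa : IsSelfAdjoint (∑ i ∈ s, a i) := .of_nonneg (Finset.sum_nonneg ha)
    have h := CStarAlgebra.star_left_conjugate_le_norm_smul (a := T) hSsa
    rw [hTsa] at h
    refine h.trans ?_
    have h0 : 0 ≤ T * T := by simpa [hTsa] using star_mul_self_nonneg T
    simpa using smul_le_smul_of_nonneg_right hs h0
  have h2 := hsum.trans (add_le_add_right hS _)
  rw [← sub_nonneg]
  refine h2.trans_eq ?_
  abel

/-! ### Ramps and Kadison's inequality -/

/-- The ramp that is `0` up to `i` and `1` from `i + 1` on. -/
noncomputable def unitRamp (i : ℕ) (u : ℝ) : ℝ := min (max (u - i) 0) 1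

theorem continuous_unitRamp (i : ℕ) : Continuous (unitRamp i) := by
  unfold unitRamp; fun_prop

theorem unitRamp_zero (i : ℕ) : unitRamp i 0 = 0 := by
  simp [unitRamp]

theorem unitRamp_nonneg (i : ℕ) (u : ℝ) : 0 ≤ unitRamp i u := by
  simp [unitRamp]

theorem unitRamp_le_one (i : ℕ) (u : ℝ) : unitRamp i u ≤ 1 := min_le_right _ _

theorem unitRamp_of_le {i : ℕ} {u : ℝ} (h : u ≤ i) : unitRamp i u = 0 := by
  simp [unitRamp, h]

theorem unitRamp_succ_le (i : ℕ) (u : ℝ) : unitRamp (i + 1) u ≤ unitRamp i u := by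
  unfold unitRamp
  gcongr
  simp

/-- Abel summation, since the first n ramps add up to `min u n`. -/
theorem sum_unitRamp (n : ℕ) {u : ℝ} (hu : 0 ≤ u) :
    ∑ i ∈ Finset.range n, ((i : ℝ) + 1) * (unitRamp i u - unitRamp (i + 1) u)
      = min u n - n * unitRamp n u := by
  induction n with
  | zero => simp [hu]
  | succ n ih =>
    rw [Finset.sum_range_succ, ih]
    have : min u ((n + 1 : ℕ) : ℝ) = min u n + unitRamp n u := by
      unfold unitRamp
      push_cast
      rcases le_total u n with h | h
      · rw [min_eq_left (by linarith), min_eq_left h, max_eq_right (by linarith)]; simp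
      · rw [min_eq_right h, max_eq_left (by linarith)]
        rcases le_total u (n + 1) with h' | h'
        · rw [min_eq_left h', min_eq_left (by linarith)]; ring
        · rw [min_eq_right h', min_eq_right (by linarith)]
    rw [this]
    push_cast
    ring

/-- The difference of ramps vanishes for u ≤ i; otherwise i + 1 ≤ u + 1. -/
theorem succ_mul_unitRamp_sub_le (i : ℕ) (u : ℝ) :
    ((i : ℝ) + 1) * (unitRamp i u - unitRamp (i + 1) u)
      ≤ (u + 1) * (unitRamp i u - unitRamp (i + 1) u) := by
  rcases le_total u i with h | h
  · rw [unitRamp_of_le h, unitRamp_of_le (by push_cast; linarith)]; simp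
  · have := unitRamp_succ_le i u
    gcongr

/-- Kadison's inequality for contractive positive maps at a positive element, up to `δ`. -/
theorem PositiveLinearMap.map_mul_map_le_add {A B : Type*} [NonUnitalCStarAlgebra A]
    [PartialOrder A] [StarOrderedRing A] [NonUnitalCStarAlgebra B] [PartialOrder B]
    [StarOrderedRing B] (P : A →ₚ[ℂ] B) (hP : ∀ x, ‖P x‖ ≤ ‖x‖) {y : A} (hy : 0 ≤ y)
    {δ : ℝ} (hδ : 0 < δ) : P y * P y ≤ P (y * y) + δ • P y := by
  have hsmul : ∀ (r : ℝ) (x : A), P (r • x) = r • P x :=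
    fun r x => P.toLinearMap.map_smul_of_tower r x
  have hsa : IsSelfAdjoint y := .of_nonneg hy
  have hrhs : y * y + δ • y = cfcₙ (fun t : ℝ => t * t + δ * t) y := by
    rw [cfcₙ_add (fun t : ℝ => t * t) (fun t => δ * t) y,
      cfcₙ_mul (fun t : ℝ => t) (fun t => t) y, cfcₙ_const_mul δ (fun t => t) y,
      cfcₙ_id' ℝ y]
  -- With this n the last ramp vanishes on the spectrum of y / δ, so the bumps reproduce y exactly.
  set n := ⌈‖y‖ / δ⌉₊
  have hσ0 : ∀ t ∈ quasispectrum ℝ y, 0 ≤ t / δ := fun t ht =>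
    div_nonneg (quasispectrum_nonneg_of_nonneg y hy t ht) hδ.le
  have hσn : ∀ t ∈ quasispectrum ℝ y, t / δ ≤ n := by
    intro t ht
    have h1 : ‖t‖ ≤ ‖y‖ := by
      simpa [cfcₙ_id' ℝ y] using norm_apply_le_norm_cfcₙ (fun t : ℝ => t) y ht
    have h2 : t ≤ ‖y‖ := (le_abs_self t).trans h1
    exact (div_le_div_of_nonneg_right h2 hδ.le).trans (Nat.le_ceil _)
  set f : ℕ → ℝ → ℝ := fun i t => unitRamp i (t / δ) - unitRamp (i + 1) (t / δ) with hf
  have hfc : ∀ i, Continuous (f i) := fun i =>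
    ((continuous_unitRamp i).comp (continuous_id.div_const δ)).sub
      ((continuous_unitRamp (i + 1)).comp (continuous_id.div_const δ))
  have hf0 : ∀ i, f i 0 = 0 := fun i => by simp [hf, unitRamp_zero]
  have hfnn : ∀ i t, 0 ≤ f i t := fun i t => sub_nonneg.2 (unitRamp_succ_le i _)
  set p : ℕ → A := fun i => cfcₙ (f i) y with hp
  set l : ℕ → ℝ := fun i => ((i : ℝ) + 1) * δ with hl
  have hpnn : ∀ i, 0 ≤ p i := fun i => cfcₙ_nonneg fun t _ => hfnn i t
  have hsumcfc : ∀ g : ℕ → ℝ, ∑ i ∈ Finset.range n, g i • p i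
      = cfcₙ (fun t => ∑ i ∈ Finset.range n, g i * f i t) y := by
    intro g
    have h := cfcₙ_sum (fun i t => g i * f i t) y (Finset.range n)
      (fun i _ => ((hfc i).const_mul (g i)).continuousOn) (fun i _ => by simp [hf0])
    have h' : (∑ i ∈ Finset.range n, fun t => g i * f i t)
        = fun t => ∑ i ∈ Finset.range n, g i * f i t := by ext; simp
    rw [h'] at h
    rw [h]
    exact Finset.sum_congr rfl fun i _ =>
      (cfcₙ_const_mul (g i) (f i) y (hfc i).continuousOn (hf0 i)).symm
  have hlin : ∀ t ∈ quasispectrum ℝ y, ∑ i ∈ Finset.range n, l i * f i t = t := by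
    intro t ht
    have h := sum_unitRamp n (hσ0 t ht)
    rw [unitRamp_of_le (hσn t ht), min_eq_left (hσn t ht)] at h
    have h2 : ∑ i ∈ Finset.range n, l i * f i t
        = δ * ∑ i ∈ Finset.range n,
          ((i : ℝ) + 1) * (unitRamp i (t / δ) - unitRamp (i + 1) (t / δ)) := by
      rw [Finset.mul_sum]
      exact Finset.sum_congr rfl fun i _ => by simp only [hl, hf]; ring
    rw [h2, h]
    field_simp
    ring
  have hy_eq : y = ∑ i ∈ Finset.range n, l i • p i := by
    rw [hsumcfc, cfcₙ_congr hlin, cfcₙ_id' ℝ y]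
  have hnorm : ‖∑ i ∈ Finset.range n, P (p i)‖ ≤ 1 := by
    rw [← map_sum]
    refine (hP _).trans ?_
    have h := hsumcfc fun _ => 1
    simp only [one_smul, one_mul] at h
    rw [h]
    refine norm_cfcₙ_le fun t _ => ?_
    have h' : ∑ i ∈ Finset.range n, f i t = unitRamp 0 (t / δ) - unitRamp n (t / δ) :=
      Finset.sum_range_sub' (fun i => unitRamp i (t / δ)) n
    rw [Real.norm_of_nonneg (Finset.sum_nonneg fun i _ => hfnn i t), h']
    linarith [unitRamp_nonneg n (t / δ), unitRamp_le_one 0 (t / δ)]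
  have hPp : ∀ i ∈ Finset.range n, 0 ≤ P (p i) := fun i _ => map_nonneg P (hpnn i)
  have key := sum_smul_mul_self_le (Finset.range n) (fun i => P (p i)) l hPp hnorm
  have hPy : P y = ∑ i ∈ Finset.range n, l i • P (p i) := by
    conv_lhs => rw [hy_eq]
    simp [map_sum, hsmul]
  have hsq : ∑ i ∈ Finset.range n, (l i * l i) • p i ≤ y * y + δ • y := by
    rw [hsumcfc, hrhs]
    refine cfcₙ_mono (fun t ht => ?_)
      (continuous_finsetSum _ fun i _ => (hfc i).const_mul _).continuousOn
      (by fun_prop) (by simp [hf0]) (by ring)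
    calc ∑ i ∈ Finset.range n, l i * l i * f i t
        ≤ ∑ i ∈ Finset.range n, (t + δ) * (l i * f i t) := by
          refine Finset.sum_le_sum fun i _ => ?_
          have h := mul_le_mul_of_nonneg_left (succ_mul_unitRamp_sub_le i (t / δ))
            (show 0 ≤ l i * δ by positivity)
          have e : (t / δ + 1) * δ = t + δ := by field_simp
          calc l i * l i * f i t = l i * δ * (((i : ℝ) + 1) * f i t) := by
                simp only [hl]; ring
            _ ≤ l i * δ * ((t / δ + 1) * f i t) := h
            _ = (t + δ) * (l i * f i t) := by rw [← e]; ring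
      _ = t * t + δ * t := by rw [← Finset.mul_sum, hlin t ht]; ring
  calc P y * P y ≤ ∑ i ∈ Finset.range n, (l i * l i) • P (p i) := by rw [hPy]; exact key
    _ = P (∑ i ∈ Finset.range n, (l i * l i) • p i) := by simp [map_sum, hsmul]
    _ ≤ P (y * y + δ • y) := OrderHomClass.mono P hsq
    _ = P (y * y) + δ • P y := by rw [map_add, hsmul]

theorem le_of_forall_pos_le_add_smul {B : Type*} [NonUnitalCStarAlgebra B] [PartialOrder B]
    [StarOrderedRing B] {a b c : B} (h : ∀ δ : ℝ, 0 < δ → a ≤ b + δ • c) : a ≤ b := by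
  have ht : Tendsto (fun δ : ℝ => b + δ • c) (𝓝[>] 0) (𝓝 b) := by
    have : Continuous fun δ : ℝ => b + δ • c := by fun_prop
    simpa using (this.tendsto 0).mono_left nhdsWithin_le_nhds
  exact ge_of_tendsto ht (eventually_nhdsWithin_of_forall fun δ hδ => h δ hδ)

/-- Kadison's inequality for contractive positive maps at a positive element. -/
theorem PositiveLinearMap.map_mul_map_le {A B : Type*} [NonUnitalCStarAlgebra A]
    [PartialOrder A] [StarOrderedRing A] [NonUnitalCStarAlgebra B] [PartialOrder B]
    [StarOrderedRing B] (P : A →ₚ[ℂ] B) (hP : ∀ x, ‖P x‖ ≤ ‖x‖) {y : A} (hy : 0 ≤ y) :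
    P y * P y ≤ P (y * y) :=
  le_of_forall_pos_le_add_smul fun _ hδ => P.map_mul_map_le_add hP hy hδ

/-! ### Ogasawara's theorem -/

section Ogasawara

variable {A : Type*} [NonUnitalCStarAlgebra A] [PartialOrder A] [StarOrderedRing A]

/-- The derivative at δ = 0 of a² ≤ (a + δb)². -/
theorem mul_add_mul_nonneg_of_mul_self_mono
    (hsq : ∀ a b : A, 0 ≤ a → a ≤ b → a * a ≤ b * b) {a b : A} (ha : 0 ≤ a) (hb : 0 ≤ b) :
    0 ≤ a * b + b * a := by
  refine le_of_forall_pos_le_add_smul (c := b * b) fun δ hδ => ?_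
  have h := hsq a (a + δ • b) ha (le_add_of_nonneg_right (smul_nonneg hδ.le hb))
  have h2 : 0 ≤ δ • (a * b + b * a + δ • (b * b)) := by
    rw [← sub_nonneg] at h
    refine h.trans_eq ?_
    simp only [mul_add, add_mul, smul_mul_assoc, mul_smul_comm]
    module
  simpa [smul_smul, hδ.ne'] using smul_nonneg (inv_nonneg.2 hδ.le) h2

theorem le_of_mul_self_le_mul_self {a b : A} (ha : 0 ≤ a) (hb : 0 ≤ b)
    (h : a * a ≤ b * b) : a ≤ b := by
  simpa [CFC.sqrt_mul_self a ha, CFC.sqrt_mul_self b hb] using CFC.sqrt_le_sqrt _ _ h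

/-- The hypotheses give (r² + 1)b⁴ ≤ a⁴, and the square root is operator monotone. -/
theorem smul_mul_self_le_of_jordan_nonneg
    (hJ : ∀ a b : A, 0 ≤ a → 0 ≤ b → 0 ≤ a * b + b * a) {a b : A} (ha : 0 ≤ a)
    (hb : IsSelfAdjoint b) {r : ℝ} (hr : 1 ≤ r) (h1 : r • (b * b) ≤ a * a)
    (h2 : r • ((a * b + b * a) * (a * b + b * a)) ≤ (a * a - b * b) * (a * a - b * b)) :
    √(r * r + 1) • (b * b) ≤ a * a := by
  have hr0 : 0 ≤ r := by linarith
  have hsa := (IsSelfAdjoint.of_nonneg ha).star_eq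
  have hbb : 0 ≤ b * b := by simpa [hb.star_eq] using star_mul_self_nonneg b
  have haa : 0 ≤ a * a := by simpa [hsa] using star_mul_self_nonneg a
  have hbbbb : 0 ≤ (b * b) * (b * b) := by
    simpa [hb.star_eq] using star_mul_self_nonneg (b * b)
  have t1 := sub_nonneg.2 h1
  have t2 := sub_nonneg.2 h2
  have t3 : 0 ≤ a * (b * b) * a := by simpa [hsa] using star_left_conjugate_nonneg hbb a
  have t4 : 0 ≤ b * (a * a - r • (b * b)) * b := by
    simpa [hb.star_eq] using star_left_conjugate_nonneg t1 b
  have t5 : 0 ≤ b * a * b := by simpa [hb.star_eq] using star_left_conjugate_nonneg ha b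
  have t6 := hJ _ _ ha t5
  have t7 := hJ _ _ hbb t1
  refine le_of_mul_self_le_mul_self (smul_nonneg (Real.sqrt_nonneg _) hbb) haa ?_
  rw [smul_mul_smul_comm, Real.mul_self_sqrt (by positivity), ← sub_nonneg]
  -- This sum is exactly a⁴ − (r² + 1)b⁴.
  have hsum := add_nonneg (add_nonneg (add_nonneg t2 (smul_nonneg hr0 (add_nonneg (add_nonneg
    t3 t4) t6))) t7) (smul_nonneg (show 0 ≤ 2 * r - 2 by linarith) hbbbb)
  refine hsum.trans_eq ?_
  simp only [mul_add, add_mul, mul_sub, sub_mul, smul_mul_assoc, mul_smul_comm, mul_assoc,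
    smul_add, smul_sub]
  module

/-- Let a = xy + yx, b = i(yx − xy). Replacing (x, y) by (x, yxy) turns (a, b) into ((a² − b²)/2,
(ab + ba)/2), so a constant r valid for all pairs improves to √(r² + 1). As the constants are
unbounded, b = 0. -/
theorem sqrt_smul_commutator_le_of_jordan_nonneg
    (hJ : ∀ a b : A, 0 ≤ a → 0 ≤ b → 0 ≤ a * b + b * a) (n : ℕ) :
    ∀ x y : A, 0 ≤ x → 0 ≤ y →
      √(n + 1 : ℝ) • ((Complex.I • (y * x - x * y)) * (Complex.I • (y * x - x * y)))
        ≤ (x * y + y * x) * (x * y + y * x) := by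
  have hconj : ∀ x y : A, 0 ≤ x → 0 ≤ y → 0 ≤ y * x * y := fun x y hx hy => by
    simpa [(IsSelfAdjoint.of_nonneg hy).star_eq] using star_left_conjugate_nonneg hx y
  have hI : ∀ u v : A, (Complex.I • u) * (Complex.I • v) = -(u * v) := fun u v => by
    rw [smul_mul_smul_comm, Complex.I_mul_I, neg_one_smul]
  induction n with
  | zero =>
    intro x y hx hy
    have h := hJ x (y * x * y) hx (hconj x y hx hy)
    rw [← sub_nonneg]
    -- a² − b² = 2(x·yxy + yxy·x).
    have h' := smul_nonneg (show (0 : ℝ) ≤ 2 by norm_num) h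
    refine h'.trans_eq ?_
    rw [hI]
    simp only [Nat.cast_zero, zero_add, Real.sqrt_one, mul_add, add_mul, mul_sub, sub_mul,
      mul_assoc]
    module
  | succ n ih =>
    intro x y hx hy
    set a := x * y + y * x with ha
    set b := Complex.I • (y * x - x * y) with hb
    have hb_sa : IsSelfAdjoint b := by
      rw [IsSelfAdjoint, hb, star_smul, star_sub, star_mul, star_mul,
        (IsSelfAdjoint.of_nonneg hx).star_eq, (IsSelfAdjoint.of_nonneg hy).star_eq]
      simp only [Complex.star_def, Complex.conj_I]
      module
    have h2 := ih x (y * x * y) hx (hconj x y hx hy)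
    have e1 : x * (y * x * y) + y * x * y * x = (2⁻¹ : ℝ) • (a * a - b * b) := by
      rw [hb, hI, ha]
      simp only [mul_add, add_mul, mul_sub, sub_mul, mul_assoc]
      module
    have e2 : Complex.I • (y * x * y * x - x * (y * x * y)) = (2⁻¹ : ℝ) • (a * b + b * a) := by
      rw [hb, ha]
      simp only [mul_add, add_mul, mul_sub, sub_mul, mul_assoc, smul_mul_assoc, mul_smul_comm]
      module
    rw [e1, e2, smul_mul_smul_comm, smul_mul_smul_comm, smul_comm] at h2
    have h3 := smul_le_smul_of_nonneg_left h2 (show (0 : ℝ) ≤ 4 by norm_num)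
    simp only [smul_smul] at h3
    rw [show (4 : ℝ) * (2⁻¹ * 2⁻¹) = 1 by norm_num, one_smul,
      show 4 * (2⁻¹ * 2⁻¹ * √(n + 1 : ℝ)) = √(n + 1 : ℝ) by ring] at h3
    have hr : 1 ≤ √(n + 1 : ℝ) := Real.one_le_sqrt.2 (by simp)
    have key := smul_mul_self_le_of_jordan_nonneg hJ (hJ x y hx hy) hb_sa hr (ih x y hx hy) h3
    rw [Real.mul_self_sqrt (by positivity)] at key
    push_cast
    exact key

theorem commute_of_jordan_nonneg (hJ : ∀ a b : A, 0 ≤ a → 0 ≤ b → 0 ≤ a * b + b * a)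
    {x y : A} (hx : 0 ≤ x) (hy : 0 ≤ y) : x * y = y * x := by
  have h := fun n => sqrt_smul_commutator_le_of_jordan_nonneg hJ n x y hx hy
  set a := x * y + y * x
  set b := Complex.I • (y * x - x * y) with hb
  have hb_sa : star b = b := by
    rw [hb, star_smul, star_sub, star_mul, star_mul,
      (IsSelfAdjoint.of_nonneg hx).star_eq, (IsSelfAdjoint.of_nonneg hy).star_eq]
    simp only [Complex.star_def, Complex.conj_I]
    module
  have hbb : 0 ≤ b * b := by simpa [hb_sa] using star_mul_self_nonneg b
  have hnorm : ∀ n : ℕ, √(n + 1 : ℝ) * ‖b * b‖ ≤ ‖a * a‖ := fun n => by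
    have := CStarAlgebra.norm_le_norm_of_nonneg_of_le
      (smul_nonneg (Real.sqrt_nonneg _) hbb) (h n)
    rwa [norm_smul, Real.norm_of_nonneg (Real.sqrt_nonneg _)] at this
  have hzero : ‖b * b‖ = 0 := by
    by_contra hne
    have hpos : 0 < ‖b * b‖ := (norm_nonneg _).lt_of_ne' hne
    obtain ⟨n, hn⟩ := exists_nat_gt ((‖a * a‖ / ‖b * b‖) ^ 2)
    have h1 : √(n + 1 : ℝ) ≤ ‖a * a‖ / ‖b * b‖ := (le_div_iff₀ hpos).2 (hnorm n)
    have h2 := (Real.sqrt_le_left (by positivity)).1 h1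
    linarith
  have hb0 : b = 0 := by
    rw [← CStarRing.star_mul_self_eq_zero_iff, hb_sa]
    exact norm_eq_zero.1 hzero
  rw [hb, smul_eq_zero] at hb0
  exact (sub_eq_zero.1 (hb0.resolve_left Complex.I_ne_zero)).symm

/-- Ogasawara's theorem: a C⋆-algebra in which squaring is monotone on positive elements is
commutative. -/
theorem mul_comm_of_mul_self_mono (hsq : ∀ a b : A, 0 ≤ a → a ≤ b → a * a ≤ b * b) (a b : A) :
    a * b = b * a := by
  have hpos : ∀ x y : A, 0 ≤ x → 0 ≤ y → x * y = y * x := fun x y hx hy =>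
    commute_of_jordan_nonneg (fun _ _ => mul_add_mul_nonneg_of_mul_self_mono hsq) hx hy
  have hspan : ∀ z : A, z ∈ Submodule.span ℂ {x : A | 0 ≤ x} := fun z => by
    rw [CStarAlgebra.span_nonneg]; trivial
  have hleft : ∀ x y : A, 0 ≤ x → x * y = y * x := by
    intro x y hx
    induction hspan y using Submodule.span_induction with
    | mem y hy => exact hpos x y hx hy
    | zero => simp
    | add y z _ _ hy hz => rw [mul_add, add_mul, hy, hz]
    | smul c y _ hy => rw [mul_smul_comm, smul_mul_assoc, hy]
  induction hspan a using Submodule.span_induction with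
  | mem x hx => exact hleft x b hx
  | zero => simp
  | add y z _ _ hy hz => rw [mul_add, add_mul, hy, hz]
  | smul c y _ hy => rw [mul_smul_comm, smul_mul_assoc, hy]

end Ogasawara

theorem mul_self_le_mul_self_of_comm {B : Type*} [NonUnitalCommCStarAlgebra B] [PartialOrder B]
    [StarOrderedRing B] {a b : B} (ha : 0 ≤ a) (hab : a ≤ b) : a * a ≤ b * b := by
  have h := Commute.mul_nonneg (sub_nonneg.2 hab) (add_nonneg (ha.trans hab) ha)
    (Commute.all _ _)
  rw [← sub_nonneg]
  refine h.trans_eq ?_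
  rw [sub_mul, mul_add, mul_add, mul_comm a b]
  abel

theorem mainTheorem7 {A : Type*} [NonUnitalCStarAlgebra A] [PartialOrder A] [StarOrderedRing A]
    {ι : Type*} [Preorder ι] [IsDirectedOrder ι] [Nonempty ι]
    (F : ι → Type*) [∀ α, NonUnitalCommCStarAlgebra (F α)]
    [∀ α, PartialOrder (F α)] [∀ α, StarOrderedRing (F α)]
    (φ : ∀ α, A →ₚ[ℂ] F α) (ψ : ∀ α, F α →ₚ[ℂ] A)
    (hφ : ∀ α x, ‖φ α x‖ ≤ ‖x‖) (hψ : ∀ α y, ‖ψ α y‖ ≤ ‖y‖)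
    (hlim : ∀ x : A, Filter.Tendsto (fun α => ‖x - ψ α (φ α x)‖) Filter.atTop (nhds 0)) :
    ∀ a b : A, a * b = b * a := by
  have hconv : ∀ x : A, Tendsto (fun α => ψ α (φ α x)) atTop (𝓝 x) := fun x => by
    rw [tendsto_iff_norm_sub_tendsto_zero]
    simpa only [norm_sub_rev] using hlim x
  refine mul_comm_of_mul_self_mono fun a b ha hab => ?_
  refine le_of_tendsto_of_tendsto' ((hconv a).mul (hconv a)) (hconv (b * b)) fun α => ?_
  calc ψ α (φ α a) * ψ α (φ α a) ≤ ψ α (φ α a * φ α a) :=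
        (ψ α).map_mul_map_le (hψ α) (map_nonneg (φ α) ha)
    _ ≤ ψ α (φ α b * φ α b) := OrderHomClass.mono (ψ α)
        (mul_self_le_mul_self_of_comm (map_nonneg (φ α) ha) (OrderHomClass.mono (φ α) hab))
    _ ≤ ψ α (φ α (b * b)) := OrderHomClass.mono (ψ α)
        ((φ α).map_mul_map_le (hφ α) (ha.trans hab))
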